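/- Let $G$ be a finite group with subgroups $G_+,G_-$ forming a unique factorization $G=G_+G_-$: every $g\in G$ is $g=g_+g_-$ for unique $g_+\in G_+$, $g_-\in G_-$. Equivalently every $g\in G$ is $g=\bar g_-\bar g_+$ for unique $\bar g_\pm\in G_\pm$. For $u\in G_+$ and $x\in G_-$ define ${}^u x,\ x^u\in G_-$ and $u^x,\ {}^x u\in G_+$ by $ux=({}^u x)(u^x)$ and $xu=({}^x u)(x^u)$. Let $H=H(G;G_+,G_-)$ be the bicrossproduct Hopf algebra: the complex vector space with basis $\{g\}$, $g\in G$, and $$\{g\}\{h\}=\delta_{g_+^{\,g_-},\,h_+}\{gh_-\},\qquad 1=\sum_{u\in G_+}\{u\},\qquad \Delta\{g\}=\sum_{u\in G_+}\{g_+u^{-1}({}^{u}g_-)\}\otimes\{u g_-\},$$ $$\varepsilon\{g\}=\delta_{g_+,e},\qquad S\{g\}=\{g^{-1}\}.$$ A quasi-triangular structure on $H$ is an invertible $R\in H\otimes H$ such that $\tau\Delta(a)=R\,\Delta(a)R^{-1}$ for all $a\in H$, where $\tau(a\otimes b)=b\otimes a$, and $(\Delta\otimes\mathrm{id})R=R_{13}R_{23}$,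 $(\mathrm{id}\otimes\Delta)R=R_{13}R_{12}$, $(\varepsilon\otimes\mathrm{id})R=(\mathrm{id}\otimes\varepsilon)R=1$. It is positive if all its coefficients in the basis $\{g\}\otimes\{h\}$, $g,h\in G$, are non-negative real numbers. (1) Let $\xi,\eta:G_+\to G_-$ be group homomorphisms such that (a) $G_+'=\{u\,\xi(u^{-1}):u\in G_+\}$ and $G_+''=\{\eta(u^{-1})\,u:u\in G_+\}$ are normal subgroups of $G$; (b) the map $F:G_+'\to G_+''$, $F(u\,\xi(u^{-1}))=\eta(u)\,u^{-1}$, is a group isomorphism. Then $$R=\sum_{u,v\in G_+}\{u\,(\eta(v)^{u})^{-1}\}\otimes\{v\,\xi(u)\}$$ is a positive quasi-triangular structure on $H$. (2) Conversely, for every positive quasi-triangular structure $R$ on $H$ there are group homomorphisms $\xi,\eta:G_+\to G_-$ satisfying (a) and (b) such that $R$ is given by the formula in (1); in particular all non-zero coefficients of $R$ are equal to $1$. -/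

import Mathlib

open scoped TensorProduct

namespace UniqueFactorization

variable {G : Type*} [Group G] {Gp Gm : Subgroup G}

/-! Throughout, `h : Gp.IsComplement' Gm` says that every `g : G` is `g = g₊ g₋` for unique
`g₊ ∈ Gp`, `g₋ ∈ Gm`. -/

/-- The factor `g₊` of `g = g₊ g₋`. -/
noncomputable def pos (h : Gp.IsComplement' Gm) (g : G) : Gp :=
  ⟨((Subgroup.IsComplement.equiv h) g).1, ((Subgroup.IsComplement.equiv h) g).1.2⟩

/-- The factor `g₋` of `g = g₊ g₋`. -/
noncomputable def neg (h : Gp.IsComplement' Gm) (g : G) : Gm :=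
  ⟨((Subgroup.IsComplement.equiv h) g).2, ((Subgroup.IsComplement.equiv h) g).2.2⟩

/-- The factor `ḡ₊` of `g = ḡ₋ ḡ₊`. -/
noncomputable def posBar (h : Gp.IsComplement' Gm) (g : G) : Gp := (pos h g⁻¹)⁻¹

/-- The factor `ḡ₋` of `g = ḡ₋ ḡ₊`. -/
noncomputable def negBar (h : Gp.IsComplement' Gm) (g : G) : Gm := (neg h g⁻¹)⁻¹

theorem pos_mul_neg (h : Gp.IsComplement' Gm) (g : G) : (pos h g : G) * neg h g = g :=
  Subgroup.IsComplement.equiv_fst_mul_equiv_snd h g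

theorem negBar_mul_posBar (h : Gp.IsComplement' Gm) (g : G) :
    (negBar h g : G) * posBar h g = g := by
  have := congrArg (·⁻¹) (pos_mul_neg h g⁻¹)
  simpa [negBar, posBar] using this

theorem eq_of_mul_eq (h : Gp.IsComplement' Gm) {u v : Gp} {x y : Gm}
    (e : (u : G) * x = v * y) : u = v ∧ x = y := by
  have := h.1 (a₁ := (⟨u, u.2⟩, ⟨x, x.2⟩)) (a₂ := (⟨v, v.2⟩, ⟨y, y.2⟩)) e
  simp only [Prod.mk.injEq, Subtype.mk.injEq] at this
  exact ⟨Subtype.ext this.1, Subtype.ext this.2⟩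

theorem eq_of_mul_eq' (h : Gp.IsComplement' Gm) {u v : Gp} {x y : Gm}
    (e : (x : G) * u = y * v) : u = v ∧ x = y := by
  have e' : ((u⁻¹ : Gp) : G) * (x⁻¹ : Gm) = (v⁻¹ : Gp) * (y⁻¹ : Gm) := by
    have := congrArg (·⁻¹) e
    simpa using this
  simpa using eq_of_mul_eq h e'

@[simp] theorem pos_coe_mul_coe (h : Gp.IsComplement' Gm) (u : Gp) (x : Gm) : pos h (u * x) = u :=
  (eq_of_mul_eq h (pos_mul_neg h (u * x))).1

@[simp] theorem neg_coe_mul_coe (h : Gp.IsComplement' Gm) (u : Gp) (x : Gm) : neg h (u * x) = x :=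
  (eq_of_mul_eq h (pos_mul_neg h (u * x))).2

@[simp] theorem posBar_coe_mul_coe (h : Gp.IsComplement' Gm) (u : Gp) (x : Gm) :
    posBar h (x * u) = u :=
  (eq_of_mul_eq' h (negBar_mul_posBar h (x * u))).1

@[simp] theorem negBar_coe_mul_coe (h : Gp.IsComplement' Gm) (u : Gp) (x : Gm) :
    negBar h (x * u) = x :=
  (eq_of_mul_eq' h (negBar_mul_posBar h (x * u))).2

@[simp] theorem pos_coe (h : Gp.IsComplement' Gm) (u : Gp) : pos h (u : G) = u := by
  simpa using pos_coe_mul_coe h u 1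

@[simp] theorem neg_coe (h : Gp.IsComplement' Gm) (u : Gp) : neg h (u : G) = 1 := by
  simpa using neg_coe_mul_coe h u 1

@[simp] theorem posBar_coe (h : Gp.IsComplement' Gm) (u : Gp) : posBar h (u : G) = u := by
  simpa using posBar_coe_mul_coe h u 1

/-- The right action `u ^ x` of `Gm` on `Gp`; `u x = (^u x) (u ^ x)`. -/
noncomputable def posRight (h : Gp.IsComplement' Gm) (u : Gp) (x : Gm) : Gp :=
  posBar h ((u : G) * x)

/-- The left action `^u x` of `Gp` on `Gm`; `u x = (^u x) (u ^ x)`. -/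
noncomputable def negLeft (h : Gp.IsComplement' Gm) (u : Gp) (x : Gm) : Gm :=
  negBar h ((u : G) * x)

/-- The right action `x ^ u` of `Gp` on `Gm`; `x u = (^x u) (x ^ u)`. -/
noncomputable def negRight (h : Gp.IsComplement' Gm) (x : Gm) (u : Gp) : Gm :=
  neg h ((x : G) * u)

theorem negLeft_mul_posRight (h : Gp.IsComplement' Gm) (u : Gp) (x : Gm) :
    (negLeft h u x : G) * posRight h u x = u * x :=
  negBar_mul_posBar h _

theorem act_unique (h : Gp.IsComplement' Gm) {u v : Gp} {x y : Gm}
    (e : (y : G) * v = u * x) : negLeft h u x = y ∧ posRight h u x = v := by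
  have := eq_of_mul_eq' h ((negLeft_mul_posRight h u x).trans e.symm)
  exact ⟨this.2, this.1⟩

theorem act_one (h : Gp.IsComplement' Gm) (u : Gp) :
    negLeft h u 1 = 1 ∧ posRight h u 1 = u :=
  act_unique h (by simp)

theorem one_act (h : Gp.IsComplement' Gm) (x : Gm) :
    negLeft h 1 x = x ∧ posRight h 1 x = 1 :=
  act_unique h (by simp)

theorem mul_act (h : Gp.IsComplement' Gm) (u v : Gp) (x : Gm) :
    negLeft h (u * v) x = negLeft h u (negLeft h v x) ∧
      posRight h (u * v) x = posRight h u (negLeft h v x) * posRight h v x := by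
  apply act_unique h
  have h1 := negLeft_mul_posRight h u (negLeft h v x)
  have h2 := negLeft_mul_posRight h v x
  push_cast
  rw [← mul_assoc, h1, mul_assoc, h2, mul_assoc]

theorem act_mul (h : Gp.IsComplement' Gm) (u : Gp) (x y : Gm) :
    negLeft h u (x * y) = negLeft h u x * negLeft h (posRight h u x) y ∧
      posRight h u (x * y) = posRight h (posRight h u x) y := by
  apply act_unique h
  have h1 := negLeft_mul_posRight h u x
  have h2 := negLeft_mul_posRight h (posRight h u x) y
  push_cast
  rw [mul_assoc, h2, ← mul_assoc, h1, mul_assoc]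

theorem posRight_bijective (h : Gp.IsComplement' Gm) (x : Gm) :
    Function.Bijective fun u : Gp => posRight h u x := by
  refine Function.bijective_iff_has_inverse.2 ⟨fun u => posRight h u x⁻¹, fun u => ?_, fun u => ?_⟩
  · simp only [← (act_mul h _ _ _).2, mul_inv_cancel, (act_one h _).2]
  · simp only [← (act_mul h _ _ _).2, inv_mul_cancel, (act_one h _).2]

theorem exists_eq (h : Gp.IsComplement' Gm) (g : G) : ∃ (u : Gp) (x : Gm), g = u * x :=
  ⟨pos h g, neg h g, (pos_mul_neg h g).symm⟩

theorem inv_act (h : Gp.IsComplement' Gm) (v : Gp) (x : Gm) :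
    posRight h (posRight h v x)⁻¹ (negLeft h v x)⁻¹ = v⁻¹ := by
  refine (act_unique h (y := x⁻¹) ?_).2
  have := congrArg (·⁻¹) (negLeft_mul_posRight h v x)
  simpa using this.symm

theorem posRight_eq_one (h : Gp.IsComplement' Gm) (v : Gp) (x : Gm) :
    posRight h v x = 1 ↔ v = 1 :=
  ⟨fun e => (posRight_bijective h x).1 (e.trans (one_act h x).2.symm),
    fun e => e ▸ (one_act h x).2⟩

end UniqueFactorization

/-- The underlying space of `H(G; Gp, Gm)`: the complex vector space with basis `G`. -/
def Bicrossproduct {G : Type*} [Group G] {Gp Gm : Subgroup G}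
    (_h : Gp.IsComplement' Gm) : Type _ := G →₀ ℂ

namespace Bicrossproduct

open UniqueFactorization

section Structure

variable {G : Type*} [Group G] {Gp Gm : Subgroup G} (h : Gp.IsComplement' Gm)

noncomputable instance : AddCommGroup (Bicrossproduct h) := inferInstanceAs (AddCommGroup (G →₀ ℂ))

noncomputable instance : Module ℂ (Bicrossproduct h) := inferInstanceAs (Module ℂ (G →₀ ℂ))

/-- The basis `{g}`, `g ∈ G`, of `H(G; Gp, Gm)`. -/
noncomputable def basis : Module.Basis G ℂ (Bicrossproduct h) :=
  Module.Basis.ofRepr (LinearEquiv.refl ℂ (G →₀ ℂ))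

variable {h} in
theorem induct {P : Bicrossproduct h → Prop} (a : Bicrossproduct h)
    (hadd : ∀ a b, P a → P b → P (a + b)) (hsmul : ∀ (c : ℂ) a, P a → P (c • a))
    (hof : ∀ g, P (basis h g)) : P a := by
  have ha : a ∈ Submodule.span ℂ (Set.range (basis h)) := by simp [(basis h).span_eq]
  refine Submodule.span_induction (p := fun a _ => P a) ?_ ?_ ?_ ?_ ha
  · rintro _ ⟨g, rfl⟩; exact hof g
  · simpa using hsmul 0 _ (hof 1)
  · intro a b _ _; exact hadd a b
  · intro c a _; exact hsmul c a

open Classical in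
/-- Multiplication: `{g}{k} = δ(g₊ ^ g₋, k₊) {g k₋}`. -/
noncomputable def mulLin :
    Bicrossproduct h →ₗ[ℂ] Bicrossproduct h →ₗ[ℂ] Bicrossproduct h :=
  (basis h).constr ℂ fun g => (basis h).constr ℂ fun k =>
    if posRight h (pos h g) (neg h g) = pos h k then basis h (g * neg h k) else 0

noncomputable instance : Mul (Bicrossproduct h) := ⟨fun a b => mulLin h a b⟩

theorem mul_def (a b : Bicrossproduct h) : a * b = mulLin h a b := rfl

open Classical in
theorem basis_mul_basis (g k : G) : basis h g * basis h k =
    if posRight h (pos h g) (neg h g) = pos h k then basis h (g * neg h k) else 0 := by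
  simp [mul_def, mulLin]

open Classical in
theorem basis_mul_basis' (u v : Gp) (x y : Gm) :
    basis h ((u : G) * x) * basis h ((v : G) * y) =
    if posRight h u x = v then basis h ((u : G) * (x * y : Gm)) else 0 := by
  simp [basis_mul_basis, mul_assoc]

noncomputable instance : NonUnitalNonAssocRing (Bicrossproduct h) :=
  { (inferInstance : AddCommGroup (Bicrossproduct h)) with
    mul := (· * ·)
    left_distrib := fun a b c => by simp [mul_def]
    right_distrib := fun a b c => by simp [mul_def]
    zero_mul := fun a => by simp [mul_def]
    mul_zero := fun a => by simp [mul_def] }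

theorem smul_mul' (c : ℂ) (a b : Bicrossproduct h) : c • a * b = c • (a * b) := by
  simp [mul_def]

theorem mul_smul' (c : ℂ) (a b : Bicrossproduct h) : a * c • b = c • (a * b) := by
  simp [mul_def]

theorem mul_assoc' (a b c : Bicrossproduct h) : a * b * c = a * (b * c) := by
  induction a using induct with
  | hadd a a' ha ha' => rw [add_mul, add_mul, ha, ha', add_mul]
  | hsmul r a ha => rw [smul_mul', smul_mul', ha, smul_mul']
  | hof g =>
  induction b using induct with
  | hadd a a' ha ha' => rw [mul_add, add_mul, ha, ha', add_mul, mul_add]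
  | hsmul r a ha => rw [mul_smul', smul_mul', ha, smul_mul', mul_smul']
  | hof k =>
  induction c using induct with
  | hadd a a' ha ha' => rw [mul_add, ha, ha', mul_add, mul_add]
  | hsmul r a ha => rw [mul_smul', ha, mul_smul', mul_smul']
  | hof l =>
    obtain ⟨u, x, rfl⟩ := exists_eq h g
    obtain ⟨v, y, rfl⟩ := exists_eq h k
    obtain ⟨w, z, rfl⟩ := exists_eq h l
    by_cases h1 : posRight h u x = v <;> by_cases h2 : posRight h v y = w <;>
      simp only [basis_mul_basis', h1, h2, (act_mul h _ _ _).2, mul_assoc, if_true, if_false,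
        zero_mul, mul_zero]

end Structure

section Hopf

attribute [local instance] Fintype.ofFinite

variable {G : Type*} [Group G] [Finite G] {Gp Gm : Subgroup G} (h : Gp.IsComplement' Gm)

/-- Unit: `1 = ∑ {u}` over `u ∈ Gp`. -/
noncomputable instance : One (Bicrossproduct h) := ⟨∑ u : Gp, basis h (u : G)⟩

theorem one_def : (1 : Bicrossproduct h) = ∑ u : Gp, basis h (u : G) := rfl

theorem one_mul' (a : Bicrossproduct h) : 1 * a = a := by
  classical
  induction a using induct with
  | hadd a a' ha ha' => rw [mul_add, ha, ha']
  | hsmul r a ha => rw [mul_smul', ha]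
  | hof g =>
    simp [one_def, Finset.sum_mul, basis_mul_basis, (act_one h _).2, pos_mul_neg]

theorem mul_one' (a : Bicrossproduct h) : a * 1 = a := by
  classical
  induction a using induct with
  | hadd a a' ha ha' => rw [add_mul, ha, ha']
  | hsmul r a ha => rw [smul_mul', ha]
  | hof g =>
    simp [one_def, Finset.mul_sum, basis_mul_basis]

noncomputable instance : Ring (Bicrossproduct h) :=
  { (inferInstance : NonUnitalNonAssocRing (Bicrossproduct h)) with
    one := 1
    one_mul := one_mul' h
    mul_one := mul_one' h
    mul_assoc := mul_assoc' h }

noncomputable instance : Algebra ℂ (Bicrossproduct h) :=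
  Algebra.ofModule (smul_mul' h) (mul_smul' h)

/-- Comultiplication: `Δ{g} = ∑ {g₊ u⁻¹ (^u g₋)} ⊗ {u g₋}` over `u ∈ Gp`. -/
noncomputable def comulLin : Bicrossproduct h →ₗ[ℂ] Bicrossproduct h ⊗[ℂ] Bicrossproduct h :=
  (basis h).constr ℂ fun g => ∑ u : Gp,
    basis h ((pos h g : G) * (u : G)⁻¹ * negLeft h u (neg h g)) ⊗ₜ[ℂ] basis h ((u : G) * neg h g)

open Classical in
/-- Counit: `ε{g} = δ(g₊, e)`. -/
noncomputable def counitLin : Bicrossproduct h →ₗ[ℂ] ℂ :=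
  (basis h).constr ℂ fun g => if pos h g = 1 then 1 else 0

/-- Antipode: `S{g} = {g⁻¹}`. -/
noncomputable def antipodeLin : Bicrossproduct h →ₗ[ℂ] Bicrossproduct h :=
  (basis h).constr ℂ fun g => basis h g⁻¹

theorem comulLin_basis (v : Gp) (x : Gm) : comulLin h (basis h ((v : G) * x)) =
    ∑ u : Gp, basis h (((v * u⁻¹ : Gp) : G) * negLeft h u x) ⊗ₜ[ℂ] basis h ((u : G) * x) := by
  simp only [comulLin, Module.Basis.constr_basis, pos_coe_mul_coe, neg_coe_mul_coe]
  push_cast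
  rfl

open Classical in
theorem counitLin_basis (v : Gp) (x : Gm) :
    counitLin h (basis h ((v : G) * x)) = if v = 1 then 1 else 0 := by
  simp only [counitLin, Module.Basis.constr_basis, pos_coe_mul_coe]

theorem antipodeLin_basis (g : G) : antipodeLin h (basis h g) = basis h g⁻¹ := by
  simp only [antipodeLin, Module.Basis.constr_basis]

noncomputable instance : Coalgebra ℂ (Bicrossproduct h) where
  comul := comulLin h
  counit := counitLin h
  coassoc := by
    refine (basis h).ext fun g => ?_
    obtain ⟨v, x, rfl⟩ := exists_eq h g
    simp only [LinearMap.comp_apply, comulLin_basis, map_sum, LinearMap.rTensor_tmul,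
      LinearMap.lTensor_tmul, TensorProduct.sum_tmul, TensorProduct.tmul_sum,
      LinearEquiv.coe_coe, TensorProduct.assoc_tmul]
    rw [Finset.sum_comm]
    conv_rhs => rw [Finset.sum_comm]
    rw [Finset.sum_comm]
    refine Finset.sum_congr rfl fun u _ => ?_
    refine Fintype.sum_equiv (Equiv.mulRight u) _ _ fun w => ?_
    simp [(mul_act h _ _ _).1, mul_assoc]
  rTensor_counit_comp_comul := by
    classical
    refine (basis h).ext fun g => ?_
    obtain ⟨v, x, rfl⟩ := exists_eq h g
    simp only [LinearMap.comp_apply, comulLin_basis, map_sum, LinearMap.rTensor_tmul,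
      counitLin_basis, mul_inv_eq_one, TensorProduct.mk_apply]
    rw [Finset.sum_eq_single v] <;> simp +contextual [eq_comm]
  lTensor_counit_comp_comul := by
    classical
    refine (basis h).ext fun g => ?_
    obtain ⟨v, x, rfl⟩ := exists_eq h g
    simp only [LinearMap.comp_apply, comulLin_basis, map_sum, LinearMap.lTensor_tmul,
      counitLin_basis, LinearMap.flip_apply, TensorProduct.mk_apply]
    rw [Finset.sum_eq_single 1] <;> simp +contextual [(one_act h _).1]

theorem counit_def (a : Bicrossproduct h) : Coalgebra.counit (R := ℂ) a = counitLin h a := rfl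

theorem comul_def (a : Bicrossproduct h) : Coalgebra.comul (R := ℂ) a = comulLin h a := rfl

theorem counit_mul' (a b : Bicrossproduct h) :
    counitLin h (a * b) = counitLin h a * counitLin h b := by
  classical
  induction a using induct with
  | hadd a a' ha ha' => rw [add_mul, map_add, ha, ha', map_add, add_mul]
  | hsmul r a ha => rw [smul_mul', map_smul, ha, map_smul, smul_mul_assoc]
  | hof g =>
  induction b using induct with
  | hadd a a' ha ha' => rw [mul_add, map_add, ha, ha', map_add, mul_add]
  | hsmul r a ha => rw [mul_smul', map_smul, ha, map_smul, mul_smul_comm]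
  | hof k =>
    obtain ⟨u, x, rfl⟩ := exists_eq h g
    obtain ⟨v, y, rfl⟩ := exists_eq h k
    rw [basis_mul_basis', counitLin_basis, counitLin_basis, apply_ite (counitLin h),
      counitLin_basis, map_zero]
    by_cases hu : u = 1
    · subst hu; simp [(one_act h _).2, eq_comm]
    · simp [hu]

theorem comul_mul' (a b : Bicrossproduct h) :
    comulLin h (a * b) = comulLin h a * comulLin h b := by
  classical
  induction a using induct with
  | hadd a a' ha ha' => rw [add_mul, map_add, ha, ha', map_add, add_mul]
  | hsmul r a ha => rw [smul_mul', map_smul, ha, map_smul, smul_mul_assoc]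
  | hof g =>
  induction b using induct with
  | hadd a a' ha ha' => rw [mul_add, map_add, ha, ha', map_add, mul_add]
  | hsmul r a ha => rw [mul_smul', map_smul, ha, map_smul, mul_smul_comm]
  | hof k =>
    obtain ⟨u, x, rfl⟩ := exists_eq h g
    obtain ⟨v, y, rfl⟩ := exists_eq h k
    rw [basis_mul_basis', comulLin_basis, comulLin_basis, apply_ite (comulLin h),
      comulLin_basis, map_zero, Finset.sum_mul_sum]
    simp only [Algebra.TensorProduct.tmul_mul_tmul, basis_mul_basis']
    have key : ∀ w : Gp, posRight h (u * w⁻¹) (negLeft h w x) = v * (posRight h w x)⁻¹ ↔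
        posRight h u x = v := fun w => by
      have := (mul_act h (u * w⁻¹) w x).2
      rw [inv_mul_cancel_right] at this
      rw [this, eq_mul_inv_iff_mul_eq]
    by_cases huv : posRight h u x = v
    · rw [if_pos huv]
      refine Finset.sum_congr rfl fun w _ => ?_
      rw [Finset.sum_eq_single (posRight h w x)]
      · rw [if_pos ((key w).2 huv), if_pos rfl, (act_mul h w x y).1]
      · intro z _ hz
        rw [if_neg (Ne.symm hz), TensorProduct.tmul_zero]
      · simp
    · rw [if_neg huv]
      symm
      refine Finset.sum_eq_zero fun w _ => Finset.sum_eq_zero fun z _ => ?_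
      by_cases hz : posRight h w x = z
      · subst hz
        rw [if_neg (fun hh => huv ((key w).1 hh)), TensorProduct.zero_tmul]
      · rw [if_neg hz, TensorProduct.tmul_zero]

theorem counit_one' : counitLin h 1 = 1 := by
  classical
  have : ∀ u : Gp, counitLin h (basis h (u : G)) = if u = 1 then 1 else 0 := fun u => by
    simpa using counitLin_basis h u 1
  simp [one_def, this]

theorem comul_one' : comulLin h 1 = 1 := by
  have : ∀ v : Gp, comulLin h (basis h (v : G)) =
      ∑ u : Gp, basis h ((v * u⁻¹ : Gp) : G) ⊗ₜ[ℂ] basis h (u : G) := fun v => by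
    simpa [(act_one h _).1] using comulLin_basis h v 1
  simp only [Algebra.TensorProduct.one_def, one_def, map_sum, this, TensorProduct.sum_tmul,
    TensorProduct.tmul_sum]
  rw [Finset.sum_comm]
  refine Finset.sum_congr rfl fun u _ => ?_
  exact Fintype.sum_equiv (Equiv.mulRight u⁻¹) _ _ fun w => by simp

noncomputable instance : Bialgebra ℂ (Bicrossproduct h) :=
  Bialgebra.mk' ℂ (Bicrossproduct h) (counit_one' h) (counit_mul' h _ _) (comul_one' h)
    (comul_mul' h _ _)

theorem antipodeLin_basis' (v : Gp) (x : Gm) : antipodeLin h (basis h ((v : G) * x)) =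
    basis h ((((posRight h v x)⁻¹ : Gp) : G) * ((negLeft h v x)⁻¹ : Gm)) := by
  rw [antipodeLin_basis, ← negLeft_mul_posRight h v x]
  simp

/-- The bicrossproduct Hopf algebra `H(G; Gp, Gm)`. -/
noncomputable instance : HopfAlgebra ℂ (Bicrossproduct h) where
  antipode := antipodeLin h
  mul_antipode_rTensor_comul := by
    refine (basis h).ext fun g => ?_
    obtain ⟨v, x, rfl⟩ := exists_eq h g
    simp only [LinearMap.comp_apply, comul_def, counit_def, comulLin_basis, map_sum,
      LinearMap.rTensor_tmul, counitLin_basis, LinearMap.mul'_apply, antipodeLin_basis',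
      basis_mul_basis', Algebra.linearMap_apply]
    by_cases hv : v = 1
    · subst hv
      simp only [one_mul, if_true, map_one]
      rw [one_def, ← (posRight_bijective h x).sum_comp (fun u : Gp => basis h (u : G))]
      refine Finset.sum_congr rfl fun u _ => ?_
      rw [if_pos (by rw [inv_act, one_mul, inv_inv])]
      have h1 := mul_act h u⁻¹ u x
      rw [inv_mul_cancel, (one_act h x).1, (one_act h x).2] at h1
      rw [← h1.1, inv_eq_of_mul_eq_one_right h1.2.symm]
      simp
    · rw [if_neg hv, map_zero]
      refine Finset.sum_eq_zero fun u _ => if_neg ?_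
      simpa [inv_act] using hv
  mul_antipode_lTensor_comul := by
    refine (basis h).ext fun g => ?_
    obtain ⟨v, x, rfl⟩ := exists_eq h g
    have key : ∀ u : Gp, posRight h (v * u⁻¹) (negLeft h u x) = (posRight h u x)⁻¹ ↔ v = 1 :=
      fun u => by
        have := (mul_act h (v * u⁻¹) u x).2
        rw [inv_mul_cancel_right] at this
        rw [eq_inv_iff_mul_eq_one, ← this, posRight_eq_one]
    simp only [LinearMap.comp_apply, comul_def, counit_def, comulLin_basis, map_sum,
      LinearMap.lTensor_tmul, counitLin_basis, LinearMap.mul'_apply, antipodeLin_basis',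
      basis_mul_basis', Algebra.linearMap_apply]
    by_cases hv : v = 1
    · subst hv
      simp only [if_true, map_one, mul_inv_cancel, one_def]
      refine Fintype.sum_equiv (Equiv.inv Gp) _ _ fun u => ?_
      rw [if_pos ((key u).2 rfl)]
      simp
    · rw [if_neg hv, map_zero]
      exact Finset.sum_eq_zero fun u _ => if_neg fun hu => hv ((key u).1 hu)

/-- `R` has non-negative real coefficients in the basis `{g} ⊗ {k}` of `H ⊗ H`. -/
def IsPositive (R : Bicrossproduct h ⊗[ℂ] Bicrossproduct h) : Prop :=
  ∀ g k : G, ∃ r : ℝ, 0 ≤ r ∧ ((basis h).tensorProduct (basis h)).repr R (g, k) = (r : ℂ)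

/-- `∑ {u (η(v) ^ u)⁻¹} ⊗ {v ξ(u)}` over `u, v ∈ Gp`. -/
noncomputable def rMatrix (ξ η : Gp →* Gm) : Bicrossproduct h ⊗[ℂ] Bicrossproduct h :=
  ∑ u : Gp, ∑ v : Gp,
    basis h ((u : G) * ((negRight h (η v) u)⁻¹ : Gm)) ⊗ₜ[ℂ] basis h ((v : G) * ξ u)

end Hopf

end Bicrossproduct

/-- `R ∈ H ⊗ H` is a quasi-triangular structure on the Hopf algebra `H`: it is invertible,
`τ Δ(a) = R Δ(a) R⁻¹`, `(Δ ⊗ id) R = R₁₃ R₂₃`, `(id ⊗ Δ) R = R₁₃ R₁₂` in `H ⊗ (H ⊗ H)`, and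
`(ε ⊗ id) R = 1 = (id ⊗ ε) R`. -/
structure IsQuasiTriangular {k H : Type*} [CommRing k] [Ring H] [HopfAlgebra k H]
    (R : H ⊗[k] H) : Prop where
  conj : ∃ U : (H ⊗[k] H)ˣ, (U : H ⊗[k] H) = R ∧ ∀ a : H,
    TensorProduct.comm k H H (Coalgebra.comul (R := k) a) =
      (U : H ⊗[k] H) * Coalgebra.comul (R := k) a * ((U⁻¹ : (H ⊗[k] H)ˣ) : H ⊗[k] H)
  comul_left :
    TensorProduct.assoc k H H H ((Coalgebra.comul (R := k) (A := H)).rTensor H R) =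
      Algebra.TensorProduct.map (AlgHom.id k H) Algebra.TensorProduct.includeRight R *
        (Algebra.TensorProduct.includeRight : H ⊗[k] H →ₐ[k] H ⊗[k] (H ⊗[k] H)) R
  comul_right :
    (Coalgebra.comul (R := k) (A := H)).lTensor H R =
      Algebra.TensorProduct.map (AlgHom.id k H) Algebra.TensorProduct.includeRight R *
        Algebra.TensorProduct.map (AlgHom.id k H) Algebra.TensorProduct.includeLeft R
  counit_left : TensorProduct.lid k H ((Coalgebra.counit (R := k) (A := H)).rTensor H R) = 1
  counit_right : TensorProduct.rid k H ((Coalgebra.counit (R := k) (A := H)).lTensor H R) = 1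

/-- The sets `G₊' = {u ξ(u⁻¹)}` and `G₊'' = {η(u⁻¹) u}` are normal subgroups `N'` and `N''` of `G`,
and `u ξ(u⁻¹) ↦ η(u) u⁻¹` is a group isomorphism `G₊' → G₊''`. -/
def IsRDatum {G : Type*} [Group G] {Gp Gm : Subgroup G} (ξ η : Gp →* Gm) : Prop :=
  ∃ N' N'' : Subgroup G,
    (N' : Set G) = {g | ∃ u : Gp, g = (u : G) * ξ u⁻¹} ∧
    (N'' : Set G) = {g | ∃ u : Gp, g = (η u⁻¹ : G) * u} ∧
    N'.Normal ∧ N''.Normal ∧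
    ∃ F : N' ≃* N'', ∀ (u : Gp) (hu : (u : G) * ξ u⁻¹ ∈ N'),
      (F ⟨(u : G) * ξ u⁻¹, hu⟩ : G) = (η u : G) * (u : G)⁻¹

/-! The basis element `{u x}` is an arrow from `u` to `u ^ x` in the action groupoid of `Gm` on
`Gp`, and the product of `H` is composition of arrows. Everything rests on tensors with exactly one
term for each pair of sources, `∑ c(u, v) {u A(u, v)} ⊗ {v B(u, v)}` (`tensorSum`): each
quasi-triangularity axiom then equates two sums indexed by the sources alone, so it becomes a family
of equations in `Gp`, `Gm` and `ℂ`.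

On the group side, normality of the range of `u ↦ ξ(u)⁻¹ u` is equivalent to `ξ(u) x = (^u x) ξ(u ^
x)`, and multiplicativity of `F` to `u ^ (η(v)⁻¹) v = v ^ (ξ(u)⁻¹) u` (`IsCompatible`). Conjugating
inside the two normal subgroups yields the remaining identities needed to verify the axioms for
`rMatrix` (`negLeft_inv`, `negLeft_eq`). Invertibility is automatic: `(S ⊗ id) R` is the inverse.

For the converse, `S` permutes the basis, so a positive `R` has an inverse that is also positive. No
cancellation can occur in `R R⁻¹ = 1 = R⁻¹ R`, so composable terms of `R` and `R⁻¹` must be mutually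
inverse arrows; this leaves exactly one term of `R` per pair of sources (`exists_eq_tensorSum`). The
axioms make the positive coefficients multiplicative up to permutations of the finite group `Gp`,
which forces them to be `1` (`eq_one_of_cocycle`). Then `ξ(u) = B(u, 1)` and `η(v) = A(1, v)⁻¹` are
homomorphisms, and conjugation of `Δ` gives their compatibility. -/

/-! ### Comparing and reindexing finite sums -/

theorem Module.Basis.eq_of_sum_smul_eq {K M P J : Type*} [CommRing K] [AddCommGroup M] [Module K M]
    [Fintype P] (b : Module.Basis J K M) (f f' : P → J) (hf : Function.Injective f)
    (hff' : ∀ p q, f p = f' q → p = q) (c c' : P → K)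
    (e : ∑ p, c p • b (f p) = ∑ p, c' p • b (f' p)) (p : P) (hp : c p ≠ 0) :
    f p = f' p ∧ c p = c' p := by
  classical
  have e1 := congrArg (fun m => b.repr m (f p)) e
  simp only [map_sum, map_smul, Module.Basis.repr_self, Finsupp.coe_finsetSum, Finset.sum_apply,
    Finsupp.smul_single, smul_eq_mul, mul_one, Finsupp.single_apply] at e1
  -- In the coefficient at `f p`, injectivity of `f` leaves one term on the left; `hff'` leaves at
  -- most the term with the same index on the right.
  rw [Finset.sum_eq_single p (fun q _ hq => if_neg fun hh => hq (hf hh)) (by simp), if_pos rfl,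
    Finset.sum_eq_single p (fun q _ hq => if_neg fun hh => hq (hff' p q hh.symm).symm)
      (by simp)] at e1
  by_cases hh : f' p = f p
  · rw [if_pos hh] at e1
    exact ⟨hh.symm, e1⟩
  · rw [if_neg hh] at e1
    exact absurd e1 hp

/-- Applied to `Δ`, this substitution makes the sources of the two tensor legs independent summation
variables. -/
theorem sum_sum_mul_right {K M : Type*} [Group K] [Fintype K] [AddCommMonoid M] (f : K → K → M) :
    ∑ u, ∑ w, f u w = ∑ u, ∑ w, f (u * w) w := by
  rw [Finset.sum_comm]
  conv_rhs => rw [Finset.sum_comm]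
  exact Finset.sum_congr rfl fun w _ => (Equiv.sum_comp (Equiv.mulRight w) fun u => f u w).symm

theorem sum_sum_sum_mul_right {K M : Type*} [Group K] [Fintype K] [AddCommMonoid M]
    (f : K → K → K → M) : ∑ u, ∑ v, ∑ w, f u v w = ∑ u, ∑ w, ∑ v, f (u * w) v w := by
  rw [← sum_sum_mul_right fun u w => ∑ v, f u v w]
  exact Finset.sum_congr rfl fun u _ => Finset.sum_comm

/-! ### Tensors with one term per pair of sources -/

namespace Bicrossproduct

open UniqueFactorization

variable {G : Type*} [Group G] {Gp Gm : Subgroup G} (h : Gp.IsComplement' Gm)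

/-- The basis element `{u x}`. -/
noncomputable def arrow (u : Gp) (x : Gm) : Bicrossproduct h := basis h ((u : G) * x)

/-- The basis of `H` indexed by `Gp × Gm`. -/
noncomputable def arrowBasis : Module.Basis (Gp × Gm) ℂ (Bicrossproduct h) :=
  (basis h).reindex
    { toFun := fun g => (pos h g, neg h g)
      invFun := fun p => (p.1 : G) * p.2
      left_inv := fun g => pos_mul_neg h g
      right_inv := fun p => by simp }

theorem arrowBasis_apply (p : Gp × Gm) : arrowBasis h p = arrow h p.1 p.2 := by
  simp [arrowBasis, arrow]

open Classical in
theorem arrow_mul_arrow (u v : Gp) (x y : Gm) :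
    arrow h u x * arrow h v y = if posRight h u x = v then arrow h u (x * y) else 0 :=
  basis_mul_basis' h u v x y

/-- The equality of sums of elementary 2-tensors determines the summands. -/
theorem eq_of_sum_tmul_eq [Fintype Gp] (X Y X' Y' : Gp → Gp → Gm) (c c' : Gp → Gp → ℂ)
    (e : ∑ u, ∑ v, c u v • (arrow h u (X u v) ⊗ₜ[ℂ] arrow h v (Y u v)) =
      ∑ u, ∑ v, c' u v • (arrow h u (X' u v) ⊗ₜ[ℂ] arrow h v (Y' u v)))
    (u v : Gp) (hc : c u v ≠ 0) : X u v = X' u v ∧ Y u v = Y' u v ∧ c u v = c' u v := by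
  have := Module.Basis.eq_of_sum_smul_eq ((arrowBasis h).tensorProduct (arrowBasis h))
    (P := Gp × Gp)
    (fun p => ((p.1, X p.1 p.2), (p.2, Y p.1 p.2))) (fun p => ((p.1, X' p.1 p.2), (p.2, Y' p.1 p.2)))
    (fun p q hpq => by simp only [Prod.mk.injEq] at hpq; exact Prod.ext hpq.1.1 hpq.2.1)
    (fun p q hpq => by simp only [Prod.mk.injEq] at hpq; exact Prod.ext hpq.1.1 hpq.2.1)
    (fun p => c p.1 p.2) (fun p => c' p.1 p.2)
    (by simpa [Module.Basis.tensorProduct_apply, Fintype.sum_prod_type, arrowBasis_apply] using e)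
    (u, v) hc
  simpa [and_assoc] using this

/-- The equality of sums of elementary 3-tensors determines the summands. -/
theorem eq_of_sum_tmul_tmul_eq [Fintype Gp] (X Y Z X' Y' Z' : Gp → Gp → Gp → Gm)
    (c c' : Gp → Gp → Gp → ℂ)
    (e : ∑ u, ∑ v, ∑ w, c u v w •
        (arrow h u (X u v w) ⊗ₜ[ℂ] (arrow h v (Y u v w) ⊗ₜ[ℂ] arrow h w (Z u v w))) =
      ∑ u, ∑ v, ∑ w, c' u v w •
        (arrow h u (X' u v w) ⊗ₜ[ℂ] (arrow h v (Y' u v w) ⊗ₜ[ℂ] arrow h w (Z' u v w))))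
    (u v w : Gp) (hc : c u v w ≠ 0) : X u v w = X' u v w ∧ Y u v w = Y' u v w ∧
      Z u v w = Z' u v w ∧ c u v w = c' u v w := by
  have := Module.Basis.eq_of_sum_smul_eq
    ((arrowBasis h).tensorProduct ((arrowBasis h).tensorProduct (arrowBasis h)))
    (P := Gp × Gp × Gp)
    (fun p => ((p.1, X p.1 p.2.1 p.2.2), (p.2.1, Y p.1 p.2.1 p.2.2), (p.2.2, Z p.1 p.2.1 p.2.2)))
    (fun p => ((p.1, X' p.1 p.2.1 p.2.2), (p.2.1, Y' p.1 p.2.1 p.2.2),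
      (p.2.2, Z' p.1 p.2.1 p.2.2)))
    (fun p q hpq => by
      simp only [Prod.mk.injEq] at hpq; exact Prod.ext hpq.1.1 (Prod.ext hpq.2.1.1 hpq.2.2.1))
    (fun p q hpq => by
      simp only [Prod.mk.injEq] at hpq; exact Prod.ext hpq.1.1 (Prod.ext hpq.2.1.1 hpq.2.2.1))
    (fun p => c p.1 p.2.1 p.2.2) (fun p => c' p.1 p.2.1 p.2.2)
    (by simpa [Module.Basis.tensorProduct_apply, Fintype.sum_prod_type, arrowBasis_apply] using e)
    (u, v, w) hc
  simpa [and_assoc] using this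

/-- The equality of sums of basis elements determines the summands. -/
theorem eq_of_sum_arrow_eq [Fintype Gp] (X X' : Gp → Gm) (c c' : Gp → ℂ)
    (e : ∑ u, c u • arrow h u (X u) = ∑ u, c' u • arrow h u (X' u))
    (u : Gp) (hc : c u ≠ 0) : X u = X' u ∧ c u = c' u := by
  have := Module.Basis.eq_of_sum_smul_eq (arrowBasis h)
    (fun p => (p, X p)) (fun p => (p, X' p))
    (fun p q hpq => by simp only [Prod.mk.injEq] at hpq; exact hpq.1)
    (fun p q hpq => by simp only [Prod.mk.injEq] at hpq; exact hpq.1)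
    c c' (by simpa [arrowBasis_apply] using e) u hc
  simpa using this

/-- The finiteness structure on the subgroups of a finite group used for sums. -/
@[reducible] noncomputable def subgroupFintype {G : Type*} [Group G] [Finite G] (K : Subgroup G) :
    Fintype K := Fintype.ofFinite K

attribute [local instance] subgroupFintype

variable [Finite G]

theorem comul_arrow (v : Gp) (x : Gm) : Coalgebra.comul (R := ℂ) (arrow h v x) =
    ∑ u : Gp, arrow h (v * u⁻¹) (negLeft h u x) ⊗ₜ[ℂ] arrow h u x :=
  comulLin_basis h v x

open Classical in
theorem counit_arrow (v : Gp) (x : Gm) :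
    Coalgebra.counit (R := ℂ) (arrow h v x) = if v = 1 then 1 else 0 :=
  counitLin_basis h v x

theorem one_eq_sum_arrow : (1 : Bicrossproduct h) = ∑ u : Gp, arrow h u 1 := by
  simp [one_def, arrow]

/-- `∑ c(u, v) {u A(u, v)} ⊗ {v B(u, v)}`. -/
noncomputable def tensorSum (c : Gp → Gp → ℂ) (A B : Gp → Gp → Gm) :
    Bicrossproduct h ⊗[ℂ] Bicrossproduct h :=
  ∑ u : Gp, ∑ v : Gp, c u v • (arrow h u (A u v) ⊗ₜ[ℂ] arrow h v (B u v))

variable (c : Gp → Gp → ℂ) (A B : Gp → Gp → Gm)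

/-- Here and in the next three results both sides of the coproduct axioms become sums with one term
for each triple of sources, ready for termwise comparison. -/
theorem comul_rTensor_tensorSum :
    TensorProduct.assoc ℂ _ _ _ ((Coalgebra.comul (R := ℂ) (A := Bicrossproduct h)).rTensor _
      (tensorSum h c A B)) =
    ∑ u : Gp, ∑ w : Gp, ∑ v : Gp, c (u * w) v • (arrow h u (negLeft h w (A (u * w) v)) ⊗ₜ[ℂ]
      (arrow h w (A (u * w) v) ⊗ₜ[ℂ] arrow h v (B (u * w) v))) := by
  simp only [tensorSum, map_sum, map_smul, LinearMap.rTensor_tmul, comul_arrow,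
    TensorProduct.sum_tmul, TensorProduct.assoc_tmul, Finset.smul_sum]
  rw [sum_sum_sum_mul_right]
  simp only [mul_inv_cancel_right]

theorem comul_lTensor_tensorSum :
    (Coalgebra.comul (R := ℂ) (A := Bicrossproduct h)).lTensor _ (tensorSum h c A B) =
    ∑ u : Gp, ∑ v : Gp, ∑ w : Gp, c u (v * w) • (arrow h u (A u (v * w)) ⊗ₜ[ℂ]
      (arrow h v (negLeft h w (B u (v * w))) ⊗ₜ[ℂ] arrow h w (B u (v * w)))) := by
  simp only [tensorSum, map_sum, map_smul, LinearMap.lTensor_tmul, comul_arrow,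
    TensorProduct.tmul_sum, Finset.smul_sum]
  refine Finset.sum_congr rfl fun u _ => ?_
  rw [sum_sum_mul_right]
  simp only [mul_inv_cancel_right]

theorem tensorSum_13_mul_23 :
    Algebra.TensorProduct.map (AlgHom.id ℂ (Bicrossproduct h)) Algebra.TensorProduct.includeRight
        (tensorSum h c A B) *
      (Algebra.TensorProduct.includeRight : _ →ₐ[ℂ] Bicrossproduct h ⊗[ℂ] _)
        (tensorSum h c A B) =
    ∑ u : Gp, ∑ w : Gp, ∑ v : Gp, (c u v * c w (posRight h v (B u v))) •
      (arrow h u (A u v) ⊗ₜ[ℂ] (arrow h w (A w (posRight h v (B u v))) ⊗ₜ[ℂ]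
        arrow h v (B u v * B w (posRight h v (B u v))))) := by
  classical
  simp only [tensorSum, map_sum, map_smul, Algebra.TensorProduct.map_tmul, AlgHom.coe_id, id_eq,
    Algebra.TensorProduct.includeRight_apply, Finset.sum_mul]
  simp only [Finset.mul_sum, smul_mul_smul_comm, Algebra.TensorProduct.tmul_mul_tmul, one_mul,
    mul_one, arrow_mul_arrow, TensorProduct.tmul_ite, smul_ite, smul_zero,
    Finset.sum_ite_eq, Finset.mem_univ, if_true]
  exact Finset.sum_congr rfl fun u _ => Finset.sum_comm

theorem tensorSum_13_mul_12 :
    Algebra.TensorProduct.map (AlgHom.id ℂ (Bicrossproduct h)) Algebra.TensorProduct.includeRight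
        (tensorSum h c A B) *
      Algebra.TensorProduct.map (AlgHom.id ℂ (Bicrossproduct h)) Algebra.TensorProduct.includeLeft
        (tensorSum h c A B) =
    ∑ u : Gp, ∑ v : Gp, ∑ w : Gp, (c u w * c (posRight h u (A u w)) v) •
      (arrow h u (A u w * A (posRight h u (A u w)) v) ⊗ₜ[ℂ]
        (arrow h v (B (posRight h u (A u w)) v) ⊗ₜ[ℂ] arrow h w (B u w))) := by
  classical
  simp only [tensorSum, map_sum, map_smul, Algebra.TensorProduct.map_tmul, AlgHom.coe_id, id_eq,
    Algebra.TensorProduct.includeRight_apply, Algebra.TensorProduct.includeLeft_apply,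
    Finset.sum_mul]
  simp only [Finset.mul_sum, smul_mul_smul_comm, Algebra.TensorProduct.tmul_mul_tmul, one_mul,
    mul_one, arrow_mul_arrow, TensorProduct.ite_tmul, smul_ite, smul_zero]
  refine Finset.sum_congr rfl fun u _ => ?_
  conv_rhs => rw [Finset.sum_comm]
  refine Finset.sum_congr rfl fun w _ => ?_
  rw [Finset.sum_comm]
  simp only [Finset.sum_ite_eq, Finset.mem_univ, if_true]

-- The targets `u ^ A(u, v)` and `v ^ B(u, v)` select at most one term of `Δ{t x}`, and one exists
-- exactly when their product is `t`.
open Classical in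
theorem tensorSum_mul_comul (t : Gp) (x : Gm) :
    tensorSum h c A B * Coalgebra.comul (R := ℂ) (arrow h t x) =
    ∑ u : Gp, ∑ v : Gp,
      (if posRight h u (A u v) * posRight h v (B u v) = t then c u v else 0) •
        (arrow h u (A u v * negLeft h (posRight h v (B u v)) x) ⊗ₜ[ℂ] arrow h v (B u v * x)) := by
  simp only [tensorSum, comul_arrow, Finset.sum_mul]
  simp only [Finset.mul_sum, smul_mul_assoc, Algebra.TensorProduct.tmul_mul_tmul, arrow_mul_arrow,
    TensorProduct.tmul_ite, TensorProduct.ite_tmul,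
    smul_ite, smul_zero, Finset.sum_ite_eq,
    Finset.mem_univ, if_true, eq_mul_inv_iff_mul_eq, ite_smul, zero_smul]

open Classical in
theorem comm_comul_mul_tensorSum (t : Gp) (x : Gm) :
    TensorProduct.comm ℂ _ _ (Coalgebra.comul (R := ℂ) (arrow h t x)) * tensorSum h c A B =
    ∑ u : Gp, ∑ v : Gp,
      (if v * u = t then c (posRight h u x) (posRight h v (negLeft h u x)) else 0) •
        (arrow h u (x * A (posRight h u x) (posRight h v (negLeft h u x))) ⊗ₜ[ℂ]
          arrow h v (negLeft h u x * B (posRight h u x) (posRight h v (negLeft h u x)))) := by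
  simp only [tensorSum, comul_arrow, map_sum, TensorProduct.comm_tmul, Finset.sum_mul]
  simp only [Finset.mul_sum, mul_smul_comm, Algebra.TensorProduct.tmul_mul_tmul, arrow_mul_arrow,
    TensorProduct.tmul_ite, TensorProduct.ite_tmul,
    smul_ite, smul_zero, Finset.sum_ite_eq, Finset.mem_univ, if_true,
    ite_smul, zero_smul]
  refine Finset.sum_congr rfl fun u _ => ?_
  have e : ∀ v : Gp, v * u = t ↔ t * u⁻¹ = v := fun v => by
    rw [mul_inv_eq_iff_eq_mul, eq_comm]
  simp only [e, Finset.sum_ite_eq, Finset.mem_univ, if_true]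

theorem lid_counit_tensorSum :
    TensorProduct.lid ℂ _ ((Coalgebra.counit (R := ℂ) (A := Bicrossproduct h)).rTensor _
      (tensorSum h c A B)) = ∑ v : Gp, c 1 v • arrow h v (B 1 v) := by
  classical
  simp [tensorSum, map_sum, map_smul, counit_arrow]

theorem rid_counit_tensorSum :
    TensorProduct.rid ℂ _ ((Coalgebra.counit (R := ℂ) (A := Bicrossproduct h)).lTensor _
      (tensorSum h c A B)) = ∑ u : Gp, c u 1 • arrow h u (A u 1) := by
  classical
  simp [tensorSum, map_sum, map_smul, counit_arrow]

end Bicrossproduct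

/-! ### Normal subgroups and compatibility of `ξ` and `η` -/

namespace UniqueFactorization

variable {G : Type*} [Group G] {Gp Gm : Subgroup G} (h : Gp.IsComplement' Gm)

/-- The embedding `u ↦ ξ(u)⁻¹ u` of `Gp` into `G`. -/
def twist (ξ : Gp →* Gm) (u : Gp) : G := ((ξ u : Gm) : G)⁻¹ * u

/-- `ξ(u) x = (^u x) ξ(u ^ x)`, which says that `Gm` normalizes the range of `twist ξ`. -/
def IsTwisting (ξ : Gp →* Gm) : Prop :=
  ∀ (u : Gp) (x : Gm), ξ u * x = negLeft h u x * ξ (posRight h u x)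

/-- The main device below: once an element `y u` is known to lie in the range of `twist ξ`, unique
factorization determines `y` from `u`. -/
theorem eq_of_mul_eq_twist (h : Gp.IsComplement' Gm) {ξ : Gp →* Gm} {u v : Gp} {y : Gm}
    (e : (y : G) * u = twist ξ v) :
    u = v ∧ y = (ξ v)⁻¹ :=
  eq_of_mul_eq' h (e.trans (by simp [twist]))

theorem twist_injective (h : Gp.IsComplement' Gm) (ξ : Gp →* Gm) :
    Function.Injective (twist ξ) := fun u v e =>
  (eq_of_mul_eq_twist h (y := (ξ u)⁻¹) (by simpa [twist] using e)).1

variable {h} {ξ η : Gp →* Gm}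

theorem IsTwisting.twist_mul_coe (hξ : IsTwisting h ξ) (u : Gp) (x : Gm) :
    twist ξ u * x = x * twist ξ (posRight h u x) := by
  have e1 := negLeft_mul_posRight h u x
  have e2 := congrArg (Subtype.val) (hξ u x)
  simp only [Subgroup.coe_mul] at e2
  rw [twist, twist, mul_assoc, ← e1, inv_mul_eq_iff_eq_mul]
  simp only [← mul_assoc, e2, mul_inv_cancel_right]

theorem IsTwisting.twist_mul_twist (hξ : IsTwisting h ξ) (u v : Gp) :
    twist ξ u * twist ξ v = twist ξ (posRight h u (ξ v)⁻¹ * v) := by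
  have := hξ.twist_mul_coe u (ξ v)⁻¹
  simp only [Subgroup.coe_inv] at this
  rw [twist.eq_def ξ v, ← mul_assoc, this]
  simp [twist, mul_assoc]

/-- The subgroup of all `ξ(u)⁻¹ u`. -/
def IsTwisting.subgroup (hξ : IsTwisting h ξ) : Subgroup G where
  carrier := Set.range (twist ξ)
  mul_mem' := by
    rintro _ _ ⟨u, rfl⟩ ⟨v, rfl⟩
    exact ⟨_, (hξ.twist_mul_twist u v).symm⟩
  one_mem' := ⟨1, by simp [twist]⟩
  inv_mem' := by
    rintro _ ⟨u, rfl⟩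
    -- The witness solves `w ^ (ξ(u)⁻¹) u = 1`.
    refine ⟨posRight h u⁻¹ (ξ u), eq_inv_of_mul_eq_one_left ?_⟩
    rw [hξ.twist_mul_twist, ← (act_mul h _ _ _).2]
    simp [(act_one h _).2, twist]

theorem IsTwisting.mem_subgroup (hξ : IsTwisting h ξ) {g : G} :
    g ∈ hξ.subgroup ↔ ∃ u, twist ξ u = g := Iff.rfl

/-- `Gm` normalizes the subgroup by the twisting identity. So does `Gp`, because `u = ξ(u) · twist ξ
u` is a product of an element of `Gm` and an element of the subgroup itself. -/
theorem IsTwisting.subgroup_normal (hξ : IsTwisting h ξ) : hξ.subgroup.Normal where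
  conj_mem n hn g := by
    have hx : ∀ (x : Gm) (n), n ∈ hξ.subgroup → (x : G) * n * (x : G)⁻¹ ∈ hξ.subgroup := by
      rintro x _ ⟨u, rfl⟩
      have := hξ.twist_mul_coe (posRight h u x⁻¹) x
      rw [← (act_mul h _ _ _).2, inv_mul_cancel, (act_one h _).2] at this
      exact ⟨_, eq_mul_inv_of_mul_eq this⟩
    obtain ⟨u, x, rfl⟩ := exists_eq h g
    have hu : (u : G) = ξ u * twist ξ u := by simp [twist]
    have ht : twist ξ u ∈ hξ.subgroup := ⟨u, rfl⟩
    have := hx (ξ u) _ (mul_mem (mul_mem ht (hx x n hn)) (inv_mem ht))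
    rw [hu]
    simpa only [mul_inv_rev, mul_assoc] using this

/-- The conjugate `x⁻¹ (ξ(u)⁻¹ u) x` has `Gp`-factor `u ^ x`; as it lies in `N`, its `Gm`-factor
must be `ξ(u ^ x)⁻¹`. -/
theorem isTwisting_of_normal {N : Subgroup G} (hN : N.Normal)
    (hmem : ∀ g, g ∈ N ↔ ∃ u, twist ξ u = g) : IsTwisting h ξ := fun u x => by
  obtain ⟨w, hw⟩ := (hmem _).1 (hN.conj_mem (twist ξ u) ((hmem _).2 ⟨u, rfl⟩) (x : G)⁻¹)
  have e1 := negLeft_mul_posRight h u x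
  have := eq_of_mul_eq_twist h (ξ := ξ) (u := posRight h u x) (y := x⁻¹ * (ξ u)⁻¹ * negLeft h u x)
    (v := w) (by
      rw [hw]
      simp only [Subgroup.coe_mul, Subgroup.coe_inv, mul_assoc, e1, twist, inv_inv])
  have e2 := this.2
  rw [mul_assoc, inv_mul_eq_iff_eq_mul, inv_mul_eq_iff_eq_mul] at e2
  rw [this.1, e2]
  simp [mul_assoc]

variable (h ξ η) in
/-- The compatibility conditions on `ξ` and `η` in terms of the actions of `Gp` and `Gm` on each
other. -/
structure IsCompatible : Prop where
  left : IsTwisting h ξ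
  right : IsTwisting h η
  -- The two sides are the indices of `twist η u * twist η v` and `twist ξ v * twist ξ u`: the
  -- bijection `twist ξ u ↦ twist η u` reverses products.
  cross : ∀ u v : Gp, posRight h u (η v)⁻¹ * v = posRight h v (ξ u)⁻¹ * u

theorem IsCompatible.isRDatum (H : IsCompatible h ξ η) : IsRDatum ξ η := by
  have hsymm : ∀ u : Gp, (u : G) * ξ u⁻¹ = (twist ξ u⁻¹)⁻¹ := fun u => by simp [twist]
  refine ⟨H.left.subgroup, H.right.subgroup, ?_, ?_, H.left.subgroup_normal,
    H.right.subgroup_normal, ?_⟩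
  · ext g
    simp only [SetLike.mem_coe, Set.mem_ofPred_eq, hsymm]
    constructor
    · intro hg
      obtain ⟨u, hu⟩ := inv_mem hg
      exact ⟨u⁻¹, by rw [inv_inv, hu, inv_inv]⟩
    · rintro ⟨u, rfl⟩
      exact inv_mem ⟨u⁻¹, rfl⟩
  · ext g
    simp only [SetLike.mem_coe, Set.mem_ofPred_eq, H.right.mem_subgroup]
    exact exists_congr fun u => by simp [twist, eq_comm]
  · let e' : Gp ≃ H.left.subgroup := Equiv.ofInjective _ (twist_injective h ξ)
    let e'' : Gp ≃ H.right.subgroup := Equiv.ofInjective _ (twist_injective h η)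
    have he' : ∀ u v, e' u * e' v = e' (posRight h u (ξ v)⁻¹ * v) := fun u v =>
      Subtype.ext (H.left.twist_mul_twist u v)
    have he'' : ∀ u v, e'' u * e'' v = e'' (posRight h u (η v)⁻¹ * v) := fun u v =>
      Subtype.ext (H.right.twist_mul_twist u v)
    -- Since `u ξ(u⁻¹) = (twist ξ u⁻¹)⁻¹` and `η(u) u⁻¹ = twist η u⁻¹`, the map `F` is inversion
    -- followed by the order-reversing bijection, hence preserves products.
    refine ⟨{ toEquiv := (Equiv.inv _).trans (e'.symm.trans e''), map_mul' := fun m n => ?_ },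
      fun u hu => ?_⟩
    · obtain ⟨a, ha⟩ := e'.surjective m⁻¹
      obtain ⟨b, hb⟩ := e'.surjective n⁻¹
      simp [← ha, ← hb, he', he'', H.cross]
    · have : (⟨_, hu⟩ : H.left.subgroup)⁻¹ = e' u⁻¹ :=
        Subtype.ext (inv_eq_iff_eq_inv.2 (hsymm u))
      have he : ∀ v, (e'' v : G) = twist η v := fun v => rfl
      change (e'' (e'.symm (⟨_, hu⟩ : H.left.subgroup)⁻¹) : G) = _
      rw [this, Equiv.symm_apply_apply, he]
      simp [twist]

variable (h) in
theorem isCompatible_of_isRDatum (H : IsRDatum ξ η) : IsCompatible h ξ η := by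
  obtain ⟨N', N'', h', h'', hN', hN'', F, hF⟩ := H
  have hsymm : ∀ u : Gp, (u : G) * ξ u⁻¹ = (twist ξ u⁻¹)⁻¹ := fun u => by simp [twist]
  have m' : ∀ g, g ∈ N' ↔ ∃ u, twist ξ u = g := fun g => by
    rw [← inv_mem_iff, ← SetLike.mem_coe, h', Set.mem_ofPred_eq]
    simp only [hsymm, inv_inj]
    exact ⟨fun ⟨u, hu⟩ => ⟨_, hu.symm⟩, fun ⟨u, hu⟩ => ⟨u⁻¹, by rw [inv_inv, hu]⟩⟩
  have m'' : ∀ g, g ∈ N'' ↔ ∃ u, twist η u = g := fun g => by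
    rw [← SetLike.mem_coe, h'', Set.mem_ofPred_eq]
    exact exists_congr fun u => by simp [twist, eq_comm]
  have H' : IsTwisting h ξ := isTwisting_of_normal hN' m'
  have H'' : IsTwisting h η := isTwisting_of_normal hN'' m''
  refine ⟨H', H'', fun u v => twist_injective h η ?_⟩
  let θ : Gp → N' := fun u => ⟨twist ξ u, (m' _).2 ⟨u, rfl⟩⟩
  have hθ : ∀ u, (F (θ u)⁻¹ : G) = twist η u := fun u => by
    have e : (u⁻¹ : Gp) * (ξ u⁻¹⁻¹ : G) = (twist ξ u)⁻¹ := by rw [hsymm, inv_inv]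
    have := hF u⁻¹ (e ▸ inv_mem (θ u).2)
    have e3 : (θ u)⁻¹ = ⟨_, e ▸ inv_mem (θ u).2⟩ := Subtype.ext e.symm
    rw [e3, this]
    simp [twist]
  have hm : θ v * θ u = θ (posRight h v (ξ u)⁻¹ * u) := Subtype.ext (H'.twist_mul_twist v u)
  rw [← H''.twist_mul_twist, ← hθ, ← hθ, ← hθ, ← hm, mul_inv_rev, map_mul, Subgroup.coe_mul]

/-- The condition `cross` at `v ^ ξ(u)`. It matches the supports of `R Δ` and `τΔ R`, and drives the
two conjugation arguments that follow. -/
theorem IsCompatible.posRight_mul_posRight (H : IsCompatible h ξ η) (u v : Gp) :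
    posRight h u (η (posRight h v (ξ u)))⁻¹ * posRight h v (ξ u) = v * u := by
  rw [H.cross, ← (act_mul h _ _ _).2, mul_inv_cancel, (act_one h _).2]

/-- With `w = v ^ ξ(u)`, the conjugate of `twist η w` by `u` factors as `(^u η(w)⁻¹) v`; normality
then identifies its `Gm`-factor. -/
theorem IsCompatible.negLeft_inv (H : IsCompatible h ξ η) (u v : Gp) :
    negLeft h u (η (posRight h v (ξ u)))⁻¹ = (η v)⁻¹ := by
  set w := posRight h v (ξ u) with hw
  obtain ⟨z, hz⟩ := H.right.subgroup_normal.conj_mem (twist η w) ⟨w, rfl⟩ (u : G)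
  have e1 := negLeft_mul_posRight h u (η w)⁻¹
  have e2 := congrArg (Subtype.val) (H.posRight_mul_posRight u v)
  simp only [← hw, Subgroup.coe_mul, Subgroup.coe_inv] at e1 e2
  have := eq_of_mul_eq_twist h (ξ := η) (u := v) (y := negLeft h u (η w)⁻¹) (v := z) (by
    rw [hz, twist, ← mul_assoc, ← e1, mul_assoc _ _ (w : G), e2]
    simp [mul_assoc])
  rw [this.2, this.1]

/-- With `w = v ^ ξ(u)`, the conjugate of `twist ξ u` by `w` factors as `(^v ξ(u))⁻¹ (u ^ η(w)⁻¹)`;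
normality then identifies its `Gm`-factor. -/
theorem IsCompatible.negLeft_eq (H : IsCompatible h ξ η) (u v : Gp) :
    negLeft h v (ξ u) = ξ (posRight h u (η (posRight h v (ξ u)))⁻¹) := by
  have e2 := congrArg (Subtype.val) (H.posRight_mul_posRight u v)
  have e1 := negLeft_mul_posRight h v (ξ u)
  set w := posRight h v (ξ u) with hw
  obtain ⟨z, hz⟩ := H.left.subgroup_normal.conj_mem (twist ξ u) ⟨u, rfl⟩ (w : G)
  simp only [Subgroup.coe_mul] at e1 e2
  have := eq_of_mul_eq_twist h (ξ := ξ) (u := posRight h u (η w)⁻¹) (y := (negLeft h v (ξ u))⁻¹)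
    (v := z) (by
    rw [hz, twist, eq_mul_inv_iff_mul_eq, mul_assoc, e2, Subgroup.coe_inv, inv_mul_eq_iff_eq_mul]
    simp only [← mul_assoc, e1, mul_inv_cancel_right])
  rw [this.1, ← inv_inj, this.2]

theorem negRight_inv (x : Gm) (u : Gp) : (negRight h x u)⁻¹ = negLeft h u⁻¹ x⁻¹ := by
  refine ((act_unique h (v := (pos h ((x : G) * u))⁻¹) ?_).1).symm
  have := congrArg (·⁻¹) (pos_mul_neg h ((x : G) * u))
  simpa [negRight] using this

/-- Brings the first leg of `rMatrix` to a form involving only the actions `posRight` and `negLeft`.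
-/
theorem IsCompatible.negRight_inv_eq (H : IsCompatible h ξ η) (u v : Gp) :
    (negRight h (η v) u)⁻¹ = (η (posRight h v (ξ u)))⁻¹ := by
  rw [negRight_inv, ← H.negLeft_inv u v, ← (mul_act h _ _ _).1, inv_mul_cancel, (one_act h _).1]

end UniqueFactorization

/-! ### The inverse of `R` from the antipode -/

/-- `(S ⊗ id) R` is a left inverse of `R`. -/
theorem antipode_rTensor_mul_self {k H : Type*} [CommRing k] [Ring H] [HopfAlgebra k H]
    {R : H ⊗[k] H}
    (hΔ : TensorProduct.assoc k H H H ((Coalgebra.comul (R := k) (A := H)).rTensor H R) =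
      Algebra.TensorProduct.map (AlgHom.id k H) Algebra.TensorProduct.includeRight R *
        (Algebra.TensorProduct.includeRight : H ⊗[k] H →ₐ[k] H ⊗[k] (H ⊗[k] H)) R)
    (hε : TensorProduct.lid k H ((Coalgebra.counit (R := k) (A := H)).rTensor H R) = 1) :
    (HopfAlgebra.antipode k (A := H)).rTensor H R * R = 1 := by
  -- `M` sends `a ⊗ (b ⊗ c)` to `S(a) b ⊗ c`. On `(Δ ⊗ id) R` the antipode axiom yields `1`; on `R₁₃
  -- R₂₃` it yields `(S ⊗ id) R · R`.
  let M : H ⊗[k] (H ⊗[k] H) →ₗ[k] H ⊗[k] H :=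
    ((LinearMap.mul' k H ∘ₗ (HopfAlgebra.antipode k (A := H)).rTensor H).rTensor H) ∘ₗ
      (TensorProduct.assoc k H H H).symm.toLinearMap
  have h1 : ∀ T T' : H ⊗[k] H,
      M (Algebra.TensorProduct.map (AlgHom.id k H) Algebra.TensorProduct.includeRight T *
        (Algebra.TensorProduct.includeRight : H ⊗[k] H →ₐ[k] H ⊗[k] (H ⊗[k] H)) T') =
      (HopfAlgebra.antipode k (A := H)).rTensor H T * T' := fun T T' => by
    induction T with
    | zero => simp
    | add x y hx hy => simp only [map_add, add_mul, hx, hy]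
    | tmul a b =>
      induction T' with
      | zero => simp
      | add x y hx hy => simp only [map_add, mul_add, hx, hy]
      | tmul c d => simp [M]
  have h2 : ∀ T : H ⊗[k] H,
      M (TensorProduct.assoc k H H H ((Coalgebra.comul (R := k) (A := H)).rTensor H T)) =
      1 ⊗ₜ TensorProduct.lid k H ((Coalgebra.counit (R := k) (A := H)).rTensor H T) :=
    fun T => by
    induction T with
    | zero => simp
    | add x y hx hy => simp only [map_add, hx, hy, TensorProduct.tmul_add]
    | tmul a b =>
      have := HopfAlgebra.mul_antipode_rTensor_comul_apply (R := k) a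
      simp [M, this, Algebra.algebraMap_eq_smul_one, TensorProduct.smul_tmul]
  rw [← h1, ← hΔ, h2, hε, Algebra.TensorProduct.one_def]

/-! ### Compatible pairs give positive quasi-triangular structures -/

namespace Bicrossproduct

open UniqueFactorization

attribute [local instance] subgroupFintype

variable {G : Type*} [Group G] [Finite G] {Gp Gm : Subgroup G} (h : Gp.IsComplement' Gm)

instance : Module.Finite ℂ (Bicrossproduct h) := Module.Finite.of_basis (basis h)

theorem rMatrix_eq_tensorSum (ξ η : Gp →* Gm) : rMatrix h ξ η =
    tensorSum h (fun _ _ => 1) (fun u v => (negRight h (η v) u)⁻¹) fun u _ => ξ u := by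
  simp only [rMatrix, tensorSum, arrow, one_smul]

theorem isPositive_rMatrix (ξ η : Gp →* Gm) : IsPositive h (rMatrix h ξ η) := by
  classical
  intro g k
  refine ⟨∑ u : Gp, ∑ v : Gp, if ((u : G) * ((negRight h (η v) u)⁻¹ : Gm), (v : G) * ξ u) = (g, k)
    then 1 else 0, Finset.sum_nonneg fun u _ => Finset.sum_nonneg fun v _ => ?_, ?_⟩
  · split_ifs <;> simp
  · simp only [rMatrix, ← Module.Basis.tensorProduct_apply, map_sum, Module.Basis.repr_self,
      Finsupp.coe_finsetSum, Finset.sum_apply, Finsupp.single_apply]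
    simp only [Complex.ofReal_sum, apply_ite Complex.ofReal, Complex.ofReal_one, Complex.ofReal_zero]

theorem isQuasiTriangular_rMatrix {ξ η : Gp →* Gm} (H : IsCompatible h ξ η) :
    IsQuasiTriangular (k := ℂ) (rMatrix h ξ η) := by
  have hR : rMatrix h ξ η = tensorSum h (fun _ _ => 1) (fun u v => (η (posRight h v (ξ u)))⁻¹)
      fun u _ => ξ u := by
    simp only [rMatrix_eq_tensorSum, H.negRight_inv_eq]
  have hΔ : TensorProduct.assoc ℂ _ _ _ ((Coalgebra.comul (R := ℂ) (A := Bicrossproduct h)).rTensor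
      _ (rMatrix h ξ η)) =
      Algebra.TensorProduct.map (AlgHom.id ℂ _) Algebra.TensorProduct.includeRight
        (rMatrix h ξ η) *
      (Algebra.TensorProduct.includeRight : _ →ₐ[ℂ] Bicrossproduct h ⊗[ℂ] _) (rMatrix h ξ η) := by
    rw [hR, comul_rTensor_tensorSum, tensorSum_13_mul_23]
    simp only [map_mul, (act_mul h _ _ _).2, H.negLeft_inv, mul_one]
  have hε : TensorProduct.lid ℂ _ ((Coalgebra.counit (R := ℂ) (A := Bicrossproduct h)).rTensor _
      (rMatrix h ξ η)) = 1 := by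
    simp only [hR, lid_counit_tensorSum, map_one, one_smul, one_eq_sum_arrow]
  have hinv := antipode_rTensor_mul_self hΔ hε
  -- In a Noetherian ring a left inverse is two-sided; finite dimension supplies this here.
  have hnoeth : IsNoetherianRing (Bicrossproduct h ⊗[ℂ] Bicrossproduct h) :=
    IsNoetherianRing.of_finite ℂ _
  let U : (Bicrossproduct h ⊗[ℂ] Bicrossproduct h)ˣ :=
    ⟨_, _, mul_eq_one_comm.1 hinv, hinv⟩
  refine ⟨⟨U, rfl, fun a => ?_⟩, hΔ, ?_, hε, ?_⟩
  · rw [Units.eq_mul_inv_iff_mul_eq]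
    change _ * rMatrix h ξ η = rMatrix h ξ η * _
    suffices (LinearMap.mulRight ℂ (rMatrix h ξ η)) ∘ₗ
        (TensorProduct.comm ℂ _ _).toLinearMap ∘ₗ Coalgebra.comul =
        (LinearMap.mulLeft ℂ (rMatrix h ξ η)) ∘ₗ Coalgebra.comul from
      LinearMap.congr_fun this a
    refine (arrowBasis h).ext fun p => ?_
    simp only [arrowBasis_apply, LinearMap.comp_apply, LinearMap.mulRight_apply,
      LinearMap.mulLeft_apply, LinearEquiv.coe_coe]
    rw [hR, tensorSum_mul_comul, comm_comul_mul_tensorSum]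
    refine Finset.sum_congr rfl fun u _ => Finset.sum_congr rfl fun v _ => ?_
    have e2 : p.2 * (η (posRight h (posRight h v (ξ u)) p.2))⁻¹ =
        (η (posRight h v (ξ u)))⁻¹ * negLeft h (posRight h v (ξ u)) p.2 := by
      rw [mul_inv_eq_iff_eq_mul, mul_assoc, ← H.right, inv_mul_cancel_left]
    rw [H.posRight_mul_posRight, ← (act_mul h _ _ _).2, ← H.left, (act_mul h _ _ _).2, e2]
  · rw [hR, comul_lTensor_tensorSum, tensorSum_13_mul_12]
    simp only [(mul_act h _ _ _).2, H.negLeft_eq, map_mul, mul_inv_rev, mul_one]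
  · simp only [hR, rid_counit_tensorSum, (one_act h _).2, map_one, inv_one, one_smul,
      one_eq_sum_arrow]

end Bicrossproduct

/-! ### Positive quasi-triangular structures come from compatible pairs -/

namespace Bicrossproduct

open UniqueFactorization
open scoped ComplexOrder

attribute [local instance] subgroupFintype

variable {G : Type*} [Group G] {Gp Gm : Subgroup G} (h : Gp.IsComplement' Gm)

theorem arrowBasis_repr (a : Bicrossproduct h) (p : Gp × Gm) :
    (arrowBasis h).repr a p = (basis h).repr a ((p.1 : G) * p.2) := by
  rw [arrowBasis, Module.Basis.repr_reindex_apply]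
  rfl

/-- The basis of `H ⊗ H` formed by the `{u x} ⊗ {v y}`. -/
noncomputable def arrowBasis₂ : Module.Basis ((Gp × Gm) × (Gp × Gm)) ℂ
    (Bicrossproduct h ⊗[ℂ] Bicrossproduct h) :=
  (arrowBasis h).tensorProduct (arrowBasis h)

theorem arrowBasis₂_apply (p : (Gp × Gm) × (Gp × Gm)) :
    arrowBasis₂ h p = arrow h p.1.1 p.1.2 ⊗ₜ[ℂ] arrow h p.2.1 p.2.2 := by
  rw [arrowBasis₂, Module.Basis.tensorProduct_apply', arrowBasis_apply, arrowBasis_apply]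

theorem arrowBasis₂_repr (R : Bicrossproduct h ⊗[ℂ] Bicrossproduct h)
    (p : (Gp × Gm) × (Gp × Gm)) : (arrowBasis₂ h).repr R p =
      ((basis h).tensorProduct (basis h)).repr R ((p.1.1 : G) * p.1.2, (p.2.1 : G) * p.2.2) := by
  induction R with
  | zero => simp
  | add a b ha hb => simp only [map_add, Finsupp.add_apply, ha, hb]
  | tmul a b =>
    obtain ⟨p, q⟩ := p
    simp only [arrowBasis₂, Module.Basis.tensorProduct_repr_tmul_apply, arrowBasis_repr]

variable [Finite G]

open Classical in
theorem arrowBasis₂_mul (p q : (Gp × Gm) × (Gp × Gm)) :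
    arrowBasis₂ h p * arrowBasis₂ h q =
      if posRight h p.1.1 p.1.2 = q.1.1 ∧ posRight h p.2.1 p.2.2 = q.2.1 then
        arrowBasis₂ h ((p.1.1, p.1.2 * q.1.2), (p.2.1, p.2.2 * q.2.2)) else 0 := by
  simp only [arrowBasis₂_apply, Algebra.TensorProduct.tmul_mul_tmul, arrow_mul_arrow]
  split_ifs <;> simp_all

theorem repr_mul (T T' : Bicrossproduct h ⊗[ℂ] Bicrossproduct h) (m : (Gp × Gm) × (Gp × Gm)) :
    (arrowBasis₂ h).repr (T * T') m = ∑ p, ∑ q, (arrowBasis₂ h).repr T p *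
      (arrowBasis₂ h).repr T' q * (arrowBasis₂ h).repr (arrowBasis₂ h p * arrowBasis₂ h q) m := by
  conv_lhs => rw [← (arrowBasis₂ h).sum_repr T, ← (arrowBasis₂ h).sum_repr T']
  simp only [Finset.sum_mul, Finset.mul_sum, smul_mul_smul_comm, map_sum, map_smul,
    Finsupp.coe_finsetSum, Finset.sum_apply, Finsupp.smul_apply, smul_eq_mul]
  exact Finset.sum_comm

open Classical in
theorem repr_one (m : (Gp × Gm) × (Gp × Gm)) :
    (arrowBasis₂ h).repr 1 m = if m.1.2 = 1 ∧ m.2.2 = 1 then 1 else 0 := by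
  have : (1 : Bicrossproduct h ⊗[ℂ] Bicrossproduct h) =
      ∑ u : Gp, ∑ v : Gp, arrowBasis₂ h ((u, 1), (v, 1)) := by
    simp only [arrowBasis₂_apply, Algebra.TensorProduct.one_def, one_eq_sum_arrow,
      TensorProduct.sum_tmul, TensorProduct.tmul_sum]
    exact Finset.sum_comm
  obtain ⟨⟨u, x⟩, v, y⟩ := m
  simp only [this, map_sum, Module.Basis.repr_self, Finsupp.coe_finsetSum, Finset.sum_apply,
    Finsupp.single_apply, Prod.mk.injEq]
  by_cases hxy : x = 1 ∧ y = 1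
  · obtain ⟨rfl, rfl⟩ := hxy
    simp [ite_and]
  · rw [if_neg hxy]
    refine Finset.sum_eq_zero fun u' _ => Finset.sum_eq_zero fun v' _ => if_neg ?_
    rintro ⟨⟨-, rfl⟩, -, rfl⟩
    exact hxy ⟨rfl, rfl⟩

variable {h}

/-- Composable elements of the supports of two mutually inverse tensors with non-negative
coefficients are inverse to each other. -/
theorem mul_eq_one_of_repr_ne_zero {T T' : Bicrossproduct h ⊗[ℂ] Bicrossproduct h}
    (hT : ∀ p, 0 ≤ (arrowBasis₂ h).repr T p) (hT' : ∀ p, 0 ≤ (arrowBasis₂ h).repr T' p)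
    (e : T * T' = 1) {p q : (Gp × Gm) × (Gp × Gm)} (hp : (arrowBasis₂ h).repr T p ≠ 0)
    (hq : (arrowBasis₂ h).repr T' q ≠ 0)
    (h₁ : posRight h p.1.1 p.1.2 = q.1.1) (h₂ : posRight h p.2.1 p.2.2 = q.2.1) :
    p.1.2 * q.1.2 = 1 ∧ p.2.2 * q.2.2 = 1 := by
  classical
  by_contra hne
  -- If the composite is not an identity, its coefficient in `T T' = 1` is zero. That coefficient is
  -- a sum of non-negative terms, one of which is the product of the two non-zero coefficients.
  have hm := repr_mul h T T' ((p.1.1, p.1.2 * q.1.2), (p.2.1, p.2.2 * q.2.2))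
  rw [e, repr_one, if_neg hne] at hm
  have hterm : ∀ p' q' m, 0 ≤ (arrowBasis₂ h).repr T p' * (arrowBasis₂ h).repr T' q' *
      (arrowBasis₂ h).repr (arrowBasis₂ h p' * arrowBasis₂ h q') m := fun p' q' m => by
    refine mul_nonneg (mul_nonneg (hT p') (hT' q')) ?_
    rw [arrowBasis₂_mul]
    split_ifs
    · rw [Module.Basis.repr_self, Finsupp.single_apply]
      split_ifs <;> simp
    · simp
  have h3 := (Finset.sum_eq_zero_iff_of_nonneg
    (fun p' _ => Finset.sum_nonneg fun q' _ => hterm p' q' _)).1 hm.symm p (Finset.mem_univ _)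
  have h4 := (Finset.sum_eq_zero_iff_of_nonneg (fun q' _ => hterm p q' _)).1 h3 q
    (Finset.mem_univ _)
  rw [arrowBasis₂_mul, if_pos ⟨h₁, h₂⟩, Module.Basis.repr_self, Finsupp.single_eq_same] at h4
  simp [hp, hq] at h4

/-- The coefficient of `{u} ⊗ {v}` in `T T'` is `1`, so some pair of terms composes to it. -/
theorem exists_repr_ne_zero {T T' : Bicrossproduct h ⊗[ℂ] Bicrossproduct h} (e : T * T' = 1)
    (u v : Gp) : ∃ x y : Gm, (arrowBasis₂ h).repr T ((u, x), (v, y)) ≠ 0 ∧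
      (arrowBasis₂ h).repr T' ((posRight h u x, x⁻¹), (posRight h v y, y⁻¹)) ≠ 0 := by
  classical
  have hm := repr_mul h T T' ((u, 1), (v, 1))
  rw [e, repr_one, if_pos ⟨rfl, rfl⟩] at hm
  obtain ⟨p, -, hp⟩ := Finset.exists_ne_zero_of_sum_ne_zero (hm ▸ one_ne_zero)
  obtain ⟨q, -, hq⟩ := Finset.exists_ne_zero_of_sum_ne_zero hp
  obtain ⟨⟨hTp, hTq⟩, hpq⟩ : ((arrowBasis₂ h).repr T p ≠ 0 ∧ (arrowBasis₂ h).repr T' q ≠ 0) ∧ _ :=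
    ⟨mul_ne_zero_iff.1 (left_ne_zero_of_mul hq), right_ne_zero_of_mul hq⟩
  rw [arrowBasis₂_mul] at hpq
  split_ifs at hpq with hc
  · rw [Module.Basis.repr_self, Finsupp.single_apply] at hpq
    obtain ⟨⟨u₁, x₁⟩, v₁, y₁⟩ := p
    obtain ⟨⟨u₂, x₂⟩, v₂, y₂⟩ := q
    obtain ⟨rfl, rfl⟩ := hc
    simp only [Prod.mk.injEq, ne_eq, ite_eq_right_iff, one_ne_zero, imp_false, not_not] at hpq
    obtain ⟨⟨rfl, hx⟩, rfl, hy⟩ := hpq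
    refine ⟨x₁, y₁, hTp, ?_⟩
    rwa [inv_eq_of_mul_eq_one_right hx, inv_eq_of_mul_eq_one_right hy]
  · simp at hpq

theorem antipode_arrow (v : Gp) (x : Gm) : HopfAlgebra.antipode ℂ (arrow h v x) =
    arrow h (posRight h v x)⁻¹ (negLeft h v x)⁻¹ :=
  antipodeLin_basis' h v x

/-- The antipode sends basis elements to basis elements, so it cannot introduce signs. -/
theorem repr_antipode_rTensor_nonneg {R : Bicrossproduct h ⊗[ℂ] Bicrossproduct h}
    (hR : ∀ p, 0 ≤ (arrowBasis₂ h).repr R p) (p : (Gp × Gm) × (Gp × Gm)) :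
    0 ≤ (arrowBasis₂ h).repr
      ((HopfAlgebra.antipode ℂ (A := Bicrossproduct h)).rTensor _ R) p := by
  classical
  rw [← (arrowBasis₂ h).sum_repr R]
  simp only [map_sum, map_smul, Finsupp.coe_finsetSum, Finset.sum_apply, Finsupp.smul_apply,
    smul_eq_mul]
  refine Finset.sum_nonneg fun q _ => mul_nonneg (hR q) ?_
  rw [arrowBasis₂_apply, LinearMap.rTensor_tmul, antipode_arrow]
  have := arrowBasis₂_apply h (((posRight h q.1.1 q.1.2)⁻¹, (negLeft h q.1.1 q.1.2)⁻¹), q.2)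
  simp only at this
  rw [← this, Module.Basis.repr_self, Finsupp.single_apply]
  split_ifs <;> simp

/-- A positive quasi-triangular structure has exactly one term for each pair `(u, v)`. -/
theorem exists_eq_tensorSum {R : Bicrossproduct h ⊗[ℂ] Bicrossproduct h}
    (hR : IsQuasiTriangular (k := ℂ) R) (hpos : IsPositive h R) :
    ∃ (r : Gp → Gp → ℝ) (A B : Gp → Gp → Gm), (∀ u v, 0 < r u v) ∧
      R = tensorSum h (fun u v => r u v) A B := by
  classical
  have hR₀ : ∀ p, 0 ≤ (arrowBasis₂ h).repr R p := fun p => by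
    obtain ⟨r, hr, e⟩ := hpos (p.1.1 * p.1.2) (p.2.1 * p.2.2)
    rw [arrowBasis₂_repr, e]
    exact_mod_cast hr
  obtain ⟨U, rfl, -⟩ := hR.conj
  have hl := antipode_rTensor_mul_self hR.comul_left hR.counit_left
  have hr : (U : Bicrossproduct h ⊗[ℂ] Bicrossproduct h) *
      (HopfAlgebra.antipode ℂ (A := Bicrossproduct h)).rTensor _ ↑U = 1 := by
    rw [left_inv_eq_right_inv hl U.mul_inv, Units.mul_inv]
  have hS := repr_antipode_rTensor_nonneg hR₀
  choose A B hA hB using exists_repr_ne_zero hr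
  have huniq : ∀ u v x y, (arrowBasis₂ h).repr ↑U ((u, x), (v, y)) ≠ 0 → x = A u v ∧ y = B u v :=
    fun u v x y hxy => by
      -- The arrows inverse to `A u v` and `B u v` occur in `R⁻¹` and compose with every term of `R`
      -- with sources `(u, v)`, so that term must be the chosen one.
      have := mul_eq_one_of_repr_ne_zero hS hR₀ hl (hB u v) hxy
        (by simp [← (act_mul h _ _ _).2, (act_one h _).2])
        (by simp [← (act_mul h _ _ _).2, (act_one h _).2])
      simpa [inv_mul_eq_one, eq_comm] using this
  refine ⟨fun u v => ((arrowBasis₂ h).repr ↑U ((u, A u v), (v, B u v))).re, A, B, fun u v => ?_, ?_⟩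
  · exact (Complex.pos_iff.1 (lt_of_le_of_ne (hR₀ _) (hA u v).symm)).1
  · conv_lhs => rw [← (arrowBasis₂ h).sum_repr (U : Bicrossproduct h ⊗[ℂ] Bicrossproduct h)]
    simp only [tensorSum, Fintype.sum_prod_type]
    refine Finset.sum_congr rfl fun u _ => ?_
    rw [Finset.sum_comm]
    refine Finset.sum_congr rfl fun v _ => ?_
    rw [Finset.sum_eq_single (A u v), Finset.sum_eq_single (B u v)]
    · rw [arrowBasis₂_apply]
      congr 1
      exact Complex.ext rfl (Complex.nonneg_iff.1 (hR₀ _)).2.symm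
    · intro y _ hy
      rw [not_ne_iff.1 fun hne => hy (huniq _ _ _ _ hne).2, zero_smul]
    · simp
    · intro x _ hx
      refine Finset.sum_eq_zero fun y _ => ?_
      rw [not_ne_iff.1 fun hne => hx (huniq _ _ _ _ hne).1, zero_smul]
    · simp

/-- Multiplying over a whole variable removes the permutations that twist the multiplicativity;
positive reals of finite order are then `1`. -/
theorem eq_one_of_cocycle {r : Gp → Gp → ℝ} (hr : ∀ u v, 0 < r u v) (A : Gp → Gp → Gm)
    (ξ : Gp → Gm) (hone : ∀ v, r 1 v = 1)
    (hl : ∀ u w v, r (u * w) v = r u v * r w (posRight h v (ξ u)))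
    (hm : ∀ u v w, r u (v * w) = r u w * r (posRight h u (A u w)) v) (u v : Gp) : r u v = 1 := by
  let Q : Gp →* ℝ :=
    { toFun := fun u => ∏ v, r u v
      map_one' := by simp [hone]
      map_mul' := fun u w => by
        simp only [hl, Finset.prod_mul_distrib]
        congr 1
        exact (posRight_bijective h (ξ u)).prod_comp fun v => r w v }
  have hQ : ∀ u, ∏ v, r u v = 1 := fun u => by
    have e : Q u ^ Nat.card Gp = 1 := by rw [← map_pow, pow_card_eq_one', map_one]
    exact (pow_eq_one_iff_of_nonneg (Finset.prod_nonneg fun v _ => (hr u v).le)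
      Nat.card_pos.ne').1 e
  -- Expanding the left side by `hm` gives `r(u, v) ^ |Gp|` times a full product over the second
  -- variable. All such products are `1`.
  have e : ∏ w, r u (w * v) = ∏ w, r u w := Equiv.prod_comp (Equiv.mulRight v) (r u)
  simp only [hm, Finset.prod_mul_distrib, hQ, mul_one, Finset.prod_const] at e
  exact (pow_eq_one_iff_of_nonneg (hr u v).le (Finset.card_ne_zero.2 Finset.univ_nonempty)).1 e

theorem exists_eq_rMatrix {R : Bicrossproduct h ⊗[ℂ] Bicrossproduct h}
    (hR : IsQuasiTriangular (k := ℂ) R) (hpos : IsPositive h R) :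
    ∃ ξ η : Gp →* Gm, IsCompatible h ξ η ∧ R = rMatrix h ξ η := by
  classical
  obtain ⟨r, A, B, hr, rfl⟩ := exists_eq_tensorSum hR hpos
  have hc : ∀ u v, (r u v : ℂ) ≠ 0 := fun u v => by exact_mod_cast (hr u v).ne'
  have hL := fun u w v => eq_of_sum_tmul_tmul_eq h _ _ _ _ _ _ _ _
    ((comul_rTensor_tensorSum h _ A B).symm.trans
      (hR.comul_left.trans (tensorSum_13_mul_23 h _ A B))) u w v (hc _ _)
  have hM := fun u v w => eq_of_sum_tmul_tmul_eq h _ _ _ _ _ _ _ _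
    ((comul_lTensor_tensorSum h _ A B).symm.trans
      (hR.comul_right.trans (tensorSum_13_mul_12 h _ A B))) u v w (hc _ _)
  have hεl := fun v => eq_of_sum_arrow_eq h _ (fun _ => 1) _ (fun _ => 1)
    ((lid_counit_tensorSum h _ A B).symm.trans (hR.counit_left.trans
      (by simpa using one_eq_sum_arrow h))) v (hc _ _)
  have hr1 : ∀ u v, r u v = 1 := eq_one_of_cocycle (h := h) hr A (fun u => B u 1)
    (fun v => by exact_mod_cast (hεl v).2) (fun u w v => by
      have e1 := (hL u w v).2.2.2
      have e2 := (hM u v 1).2.2.1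
      rw [mul_one] at e2
      rw [e2] at e1
      exact_mod_cast e1)
    (fun u v w => by exact_mod_cast (hM u v w).2.2.2)
  -- Setting one group variable to `1` in the coproduct axioms shows that `B` depends only on `u`
  -- and that `A` is determined by its values at `u = 1`.
  have hB : ∀ u v, B u v = B u 1 := fun u v => by simpa using (hM u v 1).2.2.1
  have hAneg : ∀ u v, negLeft h u (A u v) = A 1 v := fun u v => by simpa using (hL 1 u v).1
  have hA : ∀ u v, A u v = A 1 (posRight h v (B u v)) := fun u v => by
    simpa using (hL u 1 v).2.1
  let ξ : Gp →* Gm := MonoidHom.mk' (fun u => B u 1) fun u w => by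
    rw [(hL u w 1).2.2.1, hB w]
  -- `v ↦ A 1 v` reverses products because `1 ∈ Gp` is fixed by `Gm`; hence the inverse.
  let η : Gp →* Gm := MonoidHom.mk' (fun v => (A 1 v)⁻¹) fun v w => by
    rw [(hM 1 v w).1, (one_act h _).2, mul_inv_rev]
  have hξ : ∀ u v, B u v = ξ u := hB
  have hη : ∀ v, A 1 v = (η v)⁻¹ := fun v => (inv_inv _).symm
  obtain ⟨U, hU, hconj⟩ := hR.conj
  have hconj' : ∀ (u v : Gp) (x : Gm),
      x * A (posRight h u x) (posRight h v (negLeft h u x)) =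
        A u v * negLeft h (posRight h v (ξ u)) x ∧
      negLeft h u x * ξ (posRight h u x) = ξ u * x ∧
      posRight h u (A u v) * posRight h v (ξ u) = v * u := fun u v x => by
    -- For `t = v u` the term of `τΔ R` at `(u, v)` is non-zero, so the support condition for `R Δ`
    -- must hold there too.
    have e := hconj (arrow h (v * u) x)
    rw [Units.eq_mul_inv_iff_mul_eq, hU, comm_comul_mul_tensorSum, tensorSum_mul_comul] at e
    have := eq_of_sum_tmul_eq h _ _ _ _ _ _ e u v (by rw [if_pos rfl]; exact hc _ _)
    rw [if_pos rfl, hξ, hξ] at this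
    refine ⟨this.1, this.2.1, ?_⟩
    by_contra hne
    rw [if_neg hne] at this
    exact hc _ _ this.2.2
  refine ⟨ξ, η, ⟨fun u x => (hconj' u 1 x).2.1.symm, fun v x => ?_, fun u v => ?_⟩, ?_⟩
  · have := (hconj' 1 v x).1
    rw [(one_act h _).1, (one_act h _).2, map_one, (act_one h _).2, hη, hη, mul_inv_eq_iff_eq_mul,
      mul_assoc, eq_inv_mul_iff_mul_eq] at this
    exact this
  -- Replacing `v` by `v ^ (ξ(u)⁻¹)` cancels the action of `ξ(u)` and turns the support identity
  -- into `cross`.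
  · have := (hconj' u (posRight h v (ξ u)⁻¹) 1).2.2
    rwa [hA, hξ, ← (act_mul h _ _ _).2, inv_mul_cancel, (act_one h _).2, hη] at this
  · rw [rMatrix_eq_tensorSum]
    simp only [hr1, Complex.ofReal_one]
    congr 1
    · funext u v
      rw [negRight_inv, ← hη, ← hAneg u v, ← (mul_act h _ _ _).1, inv_mul_cancel, (one_act h _).1]
    · funext u v
      exact hξ u v

end Bicrossproduct

theorem theorem1 {G : Type*} [Group G] [Finite G] {Gp Gm : Subgroup G}
    (h : Gp.IsComplement' Gm) :
    (∀ ξ η : Gp →* Gm, IsRDatum ξ η →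
      IsQuasiTriangular (k := ℂ) (Bicrossproduct.rMatrix h ξ η) ∧
        Bicrossproduct.IsPositive h (Bicrossproduct.rMatrix h ξ η)) ∧
    (∀ R : Bicrossproduct h ⊗[ℂ] Bicrossproduct h,
      IsQuasiTriangular (k := ℂ) R → Bicrossproduct.IsPositive h R →
        ∃ ξ η : Gp →* Gm, IsRDatum ξ η ∧ R = Bicrossproduct.rMatrix h ξ η) := by
  exact ⟨fun ξ η H => ⟨Bicrossproduct.isQuasiTriangular_rMatrix h
      (UniqueFactorization.isCompatible_of_isRDatum h H),
      Bicrossproduct.isPositive_rMatrix h ξ η⟩,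
    fun R hR hpos =>
      let ⟨ξ, η, H, e⟩ := Bicrossproduct.exists_eq_rMatrix hR hpos
      ⟨ξ, η, H.isRDatum, e⟩⟩
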